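/- Let $\mathfrak g$ be a finite-dimensional reductive Lie algebra over a field $\Bbbk$ of characteristic zero (that is, the radical of $\mathfrak g$ equals its centre). Let $e\in\mathfrak g$ satisfy $(\mathrm{ad}\,e)^3=0$, put $D=(\mathrm{ad}\,e)^2$, and let $$[x,y]'_D=D([x,y])-[Dx,y]-[x,Dy]\qquad(x,y\in\mathfrak g)$$ be the derived operation of the bracket of $\mathfrak g$ with respect to $D$. Then $[\ ,\ ]'_D$ is a Lie bracket on the vector space $\mathfrak g$, and the Lie algebra $\mathfrak g_D=(\mathfrak g,[\ ,\ ]'_D)$ is two-step nilpotent in the sense that its derived algebra lies in its centre; moreover its centre is the centraliser of $e$ in $\mathfrak g$: $$[\mathfrak g_D,\mathfrak g_D]\subset\mathfrak z(\mathfrak g_D)=\mathfrak g^e,\qquad \mathfrak g^e=\{y\in\mathfrak g\mid [e,y]=0\}.$$ -/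

import Mathlib

/-- The derived operation of the bracket of `L` with respect to a linear operator `D`:
`[x, y]'_D = D [x, y] - [D x, y] - [x, D y]`. -/
def derivedBracket {K L : Type*} [CommRing K] [LieRing L] [LieAlgebra K L]
    (D : Module.End K L) (x y : L) : L :=
  D ⁅x, y⁆ - ⁅D x, y⁆ - ⁅x, D y⁆

/-- The derived operation with respect to `D` is a Lie bracket: it is alternating and satisfies
the Jacobi identity (bilinearity is automatic). -/
structure IsLieDerivedBracket {K L : Type*} [CommRing K] [LieRing L] [LieAlgebra K L]
    (D : Module.End K L) : Prop where
  alternating : ∀ x : L, derivedBracket D x x = 0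
  jacobi : ∀ x y z : L,
    derivedBracket D x (derivedBracket D y z) + derivedBracket D y (derivedBracket D z x) +
      derivedBracket D z (derivedBracket D x y) = 0

/-- The vector space `L`, to be endowed with the bracket `[ , ]'_D`. -/
def DerivedLie {K L : Type*} [CommRing K] [LieRing L] [LieAlgebra K L]
    (D : Module.End K L) (_hD : IsLieDerivedBracket D) : Type _ := L

namespace DerivedLie

variable {K L : Type*} [CommRing K] [LieRing L] [LieAlgebra K L]
  {D : Module.End K L} {hD : IsLieDerivedBracket D}

instance instAddCommGroup : AddCommGroup (DerivedLie D hD) :=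
  inferInstanceAs (AddCommGroup L)

instance instModule : Module K (DerivedLie D hD) :=
  inferInstanceAs (Module K L)

/-- The identity map from `(L, [ , ]'_D)` to `L`, as an isomorphism of vector spaces. -/
def toBase (D : Module.End K L) (hD : IsLieDerivedBracket D) : DerivedLie D hD ≃ₗ[K] L :=
  LinearEquiv.refl K L

instance instBracket : Bracket (DerivedLie D hD) (DerivedLie D hD) :=
  ⟨fun x y => (toBase D hD).symm (derivedBracket D (toBase D hD x) (toBase D hD y))⟩

theorem toBase_lie (x y : DerivedLie D hD) :
    toBase D hD ⁅x, y⁆ = derivedBracket D (toBase D hD x) (toBase D hD y) := rfl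

theorem derivedBracket_skew (D : Module.End K L) (x y : L) :
    derivedBracket D x y = -derivedBracket D y x := by
  simp only [derivedBracket]
  rw [← lie_skew x y, ← lie_skew (D x) y, ← lie_skew x (D y), map_neg]
  abel

theorem derivedBracket_neg_right (D : Module.End K L) (x y : L) :
    derivedBracket D x (-y) = -derivedBracket D x y := by
  simp only [derivedBracket, lie_neg, map_neg]
  abel

instance instLieRing : LieRing (DerivedLie D hD) where
  add_lie x y z := (toBase D hD).injective <| by
    simp only [toBase_lie, map_add, derivedBracket, add_lie]
    abel
  lie_add x y z := (toBase D hD).injective <| by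
    simp only [toBase_lie, map_add, derivedBracket, lie_add]
    abel
  lie_self x := (toBase D hD).injective <| by
    simpa only [toBase_lie, map_zero] using hD.alternating (toBase D hD x)
  leibniz_lie x y z := (toBase D hD).injective <| by
    simp only [toBase_lie, map_add]
    generalize toBase D hD x = a
    generalize toBase D hD y = b
    generalize toBase D hD z = c
    have h := hD.jacobi a b c
    rw [derivedBracket_skew D c a, derivedBracket_neg_right,
      derivedBracket_skew D c (derivedBracket D a b)] at h
    rw [← sub_eq_zero, ← h]
    abel

instance instLieAlgebra : LieAlgebra K (DerivedLie D hD) where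
  lie_smul t x y := (toBase D hD).injective <| by
    simp only [toBase_lie, map_smul, derivedBracket, lie_smul, smul_sub]

end DerivedLie

/-!
Write `E = ad e` and `D = E ^ 2`. As `E` is a derivation, `[x, y]'_D = 2 [E x, E y]`, and expanding
`E ^ 3 [x, y] = 0` by the Leibniz rule gives `E [E x, E y] = 0`. Hence every double bracket vanishes,
which proves the Jacobi identity, and `[L, L]'_D ⊆ ker E ⊆ center`.

What remains is that `[E x, E y] = 0` for all `y` forces `E x = 0`; this is where reductivity enters.

* `mul_pow_four_eq_zero`: if `E ^ 3 = 0` and `E` commutes with `[E, Y]`, then `E Y` is nilpotent. So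
  `e` is orthogonal, for the Killing form, to every `y` with `E ^ 2 y` in the centre.
* `exists_ad_pow_two_apply_sub_mem_center`: since `E ^ 2` is self-adjoint for the Killing form, whose
  kernel is contained in the radical by Cartan's criterion, hence in the centre, duality gives `f`
  with `E ^ 2 f - e` central.
* Now `F = ad (-2 f)` and `H = [E, F]` satisfy `[H, E] = 2 E`. If `z = E x` commutes with the image
  of `E`, then it commutes with `e` and with `[e, -2 f]`, that is `E z = H z = 0`. The usual `sl₂`
  commutation relations (`apply_eq_zero_of_sl2_relations`) then give `-2 z = E ^ 2 F x`, so that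
  `z = E ^ 2 w`, and next `-6 z = E ^ 3 F w = 0`. It is not needed that `F` be part of an
  `sl₂`-triple.
-/

/-! ### Operator identities -/

/-- A case of the lemma behind the Jacobson–Morozov theorem: a nilpotent `E` commuting with
`E * Y - Y * E` has a nilpotent product with `Y`. -/
theorem mul_pow_four_eq_zero {A : Type*} [Ring A] [IsAddTorsionFree A] {E Y : A}
    (hE : E ^ 3 = 0) (hc : Commute E (E * Y - Y * E)) : (E * Y) ^ 4 = 0 := by
  obtain ⟨N, hN⟩ : ∃ N, N = E * Y - Y * E := ⟨_, rfl⟩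
  rw [← hN] at hc
  have hc : N * E = E * N := hc.eq.symm
  have hEY : Y * E = E * Y - N := by rw [hN]; abel
  have hE3 : E * (E * E) = 0 := by rw [← hE]; noncomm_ring
  -- `⁅E ^ 3, Y⁆ = 0`
  have hE2N : E * (E * N) = 0 := by
    have h : (3 : ℕ) • (E * (E * N)) = E * (E * E) * Y - Y * (E * (E * E)) := by
      calc (3 : ℕ) • (E * (E * N)) = E * (E * N) + E * (N * E) + N * E * E := by
            simp only [hc, mul_assoc]; abel
        _ = _ := by rw [hN]; noncomm_ring
    rw [hE3, zero_mul, mul_zero, sub_zero] at h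
    exact (smul_eq_zero.mp h).resolve_left (by norm_num)
  -- `⁅E ^ 2 N, Y⁆ = 0`
  have hEN2 : (2 : ℕ) • (E * (N * N)) = -(E * (E * (N * Y - Y * N))) := by
    have h : E * (E * N) * Y - Y * (E * (E * N)) =
        (2 : ℕ) • (E * (N * N)) + E * (E * (N * Y - Y * N)) := by
      calc E * (E * N) * Y - Y * (E * (E * N))
          = E * N * N + N * E * N + E * (E * (N * Y - Y * N)) := by rw [hN]; noncomm_ring
        _ = _ := by simp only [hc, mul_assoc]; abel
    rw [hE2N, zero_mul, mul_zero, sub_zero] at h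
    exact eq_neg_of_add_eq_zero_left h.symm
  have hTE : E * Y * E = E * E * Y - E * N := by rw [mul_assoc, hEY]; noncomm_ring
  have hTE2 : E * Y * E * E = 0 := by
    calc E * Y * E * E = E * E * (Y * E) - E * (N * E) := by rw [hTE]; noncomm_ring
      _ = E * (E * E) * Y - (2 : ℕ) • (E * (E * N)) := by rw [hEY, hc]; noncomm_ring
      _ = 0 := by rw [hE3, hE2N]; simp
  have hE2YN : E * E * Y * N = (2 : ℕ) • (E * (N * N)) := by
    calc E * E * Y * N = E * N * N + N * E * N + Y * (E * (E * N)) := by rw [hN]; noncomm_ring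
      _ = _ := by rw [hE2N, hc]; noncomm_ring
  have hT2E : E * Y * (E * Y * E) = -(E * (N * N)) := by
    calc E * Y * (E * Y * E) = E * Y * E * E * Y - E * Y * E * N := by
            conv_lhs => rw [hTE]
            noncomm_ring
      _ = -(E * E * Y * N) + E * (N * N) := by rw [hTE2, hTE]; noncomm_ring
      _ = _ := by rw [hE2YN]; abel
  have hT3E : E * Y * (E * Y * (E * Y * E)) = 0 := by
    have h : (2 : ℕ) • (E * Y * (E * Y * (E * Y * E))) = 0 := by
      calc (2 : ℕ) • (E * Y * (E * Y * (E * Y * E)))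
          = -(E * Y * ((2 : ℕ) • (E * (N * N)))) := by rw [hT2E]; noncomm_ring
        _ = E * Y * E * E * (N * Y - Y * N) := by rw [hEN2]; noncomm_ring
        _ = 0 := by rw [hTE2, zero_mul]
    exact (smul_eq_zero.mp h).resolve_left (by norm_num)
  calc (E * Y) ^ 4 = E * Y * (E * Y * (E * Y * E)) * Y := by noncomm_ring
    _ = 0 := by rw [hT3E, zero_mul]

/-- If `⁅H, E⁆ = 2 E` and `H = ⁅E, F⁆`, a vector in the image of `E` which is killed by `E` and
by `H` vanishes, provided `E ^ 3 = 0`. -/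
theorem apply_eq_zero_of_sl2_relations {K M : Type*} [Field K] [CharZero K] [AddCommGroup M]
    [Module K M] {E F H : Module.End K M} (hE : E ^ 3 = 0) (hH : ∀ v, H v = E (F v) - F (E v))
    (hHE : ∀ v, H (E v) - E (H v) = (2 : K) • E v)
    {x : M} (hEx : E (E x) = 0) (hHx : H (E x) = 0) : E x = 0 := by
  have hE3 (v : M) : E (E (E v)) = 0 := by simpa [pow_succ] using LinearMap.congr_fun hE v
  have hEF (v : M) : E (F v) = H v + F (E v) := by rw [hH]; abel
  have hEH (v : M) : E (H v) = H (E v) - (2 : K) • E v := by rw [← hHE]; abel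
  have h2 : E (E (F x)) = (-2 : K) • E x := by
    simp [hEF, hEH, hEx, hHx]
  obtain ⟨w, hw⟩ : ∃ w, E (E w) = E x :=
    ⟨(-2⁻¹ : K) • F x, by rw [map_smul, map_smul, h2, smul_smul]; norm_num⟩
  have h3 : E (E (E (F w))) = (-6 : K) • E x := by
    simp only [hEF, hEH, map_add, map_sub, map_smul, hw, hEx, hHx, map_zero]
    module
  rw [hE3] at h3
  exact (smul_eq_zero.mp h3.symm).resolve_left (by norm_num)

/-! ### Reductive Lie algebras -/

section Reductive

variable {K L : Type*} [Field K] [CharZero K] [LieRing L] [LieAlgebra K L]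

open LieAlgebra

theorem mem_center_of_killingForm_eq_zero [Module.Finite K L] [HasCentralRadical K L] {x : L}
    (hx : killingForm K L x = 0) : x ∈ center K L := by
  rw [← HasCentralRadical.radical_eq_center]
  apply killingCompl_top_le_radical K L
  rw [LieIdeal.mem_killingCompl]
  intro y _
  rw [LieModule.traceForm_comm]
  exact LinearMap.congr_fun hx y

theorem killingForm_eq_zero_of_ad_pow_three_eq_zero {e y : L} (he : ad K L e ^ 3 = 0)
    (hy : ⁅e, ⁅e, y⁆⁆ ∈ center K L) : killingForm K L e y = 0 := by
  have hc : Commute (ad K L e) (ad K L e * ad K L y - ad K L y * ad K L e) := by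
    ext v
    have hv : ⁅⁅e, ⁅e, y⁆⁆, v⁆ = 0 := by rw [← lie_skew, hy v, neg_zero]
    have h := leibniz_lie e ⁅e, y⁆ v
    rw [hv, zero_add] at h
    simpa [← lie_lie] using h
  have : IsAddTorsionFree (Module.End K L) := .of_isTorsionFree K _
  rw [killingForm_apply_apply]
  exact (LinearMap.isNilpotent_trace_of_isNilpotent ⟨4, mul_pow_four_eq_zero he hc⟩).eq_zero

/-- A weak form of the Jacobson–Morozov theorem: modulo the centre, `e` lies in the image of
`(ad e) ^ 2`. -/
theorem exists_ad_pow_two_apply_sub_mem_center [Module.Finite K L] [HasCentralRadical K L]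
    {e : L} (he : ad K L e ^ 3 = 0) : ∃ f : L, ⁅e, ⁅e, f⁆⁆ - e ∈ center K L := by
  -- It suffices that `κ e` lies in the range of `κ ∘ (ad e) ^ 2`, which is the annihilator of
  -- `{y | κ ((ad e) ^ 2 y) = 0}` because `(ad e) ^ 2` is self-adjoint.
  suffices h : killingForm K L e ∈ LinearMap.range (killingForm K L ∘ₗ ad K L e ∘ₗ ad K L e) by
    obtain ⟨f, hf⟩ := h
    refine ⟨f, mem_center_of_killingForm_eq_zero ?_⟩
    rw [map_sub, sub_eq_zero]
    exact hf
  rw [← Subspace.dualCoannihilator_dualAnnihilator_eq (W := LinearMap.range _),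
    Submodule.mem_dualAnnihilator]
  intro y hy
  rw [Submodule.mem_dualCoannihilator] at hy
  refine killingForm_eq_zero_of_ad_pow_three_eq_zero he (mem_center_of_killingForm_eq_zero ?_)
  ext x
  have h := hy _ ⟨x, rfl⟩
  simp only [LinearMap.comp_apply, ad_apply] at h
  rwa [LieModule.traceForm_apply_lie_apply', LieModule.traceForm_apply_lie_apply', neg_neg,
    LieModule.traceForm_comm] at h

theorem lie_eq_zero_of_forall_lie_lie_eq_zero [Module.Finite K L] [HasCentralRadical K L]
    {e x : L} (he : ad K L e ^ 3 = 0) (hx : ∀ y : L, ⁅⁅e, x⁆, ⁅e, y⁆⁆ = 0) : ⁅e, x⁆ = 0 := by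
  obtain ⟨f, hf⟩ := exists_ad_pow_two_apply_sub_mem_center he
  obtain ⟨c, hc⟩ : ∃ c, c = ⁅e, ⁅e, f⁆⁆ - e := ⟨_, rfl⟩
  rw [← hc] at hf
  have hcomm (v : L) : ⁅v, c⁆ = 0 := hf v
  have hef : ⁅e, ⁅e, f⁆⁆ = e + c := by rw [hc]; abel
  refine apply_eq_zero_of_sl2_relations (E := ad K L e) (F := ad K L ((-2 : K) • f))
    (H := ad K L ⁅e, (-2 : K) • f⁆) (x := x) he (fun v ↦ ?_) (fun v ↦ ?_) ?_ ?_
  · simp only [ad_apply]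
    rw [lie_lie]
  · simp only [ad_apply]
    rw [← lie_lie, lie_smul, smul_lie, ← lie_skew ⁅e, f⁆ e, hef, ← lie_skew, lie_smul, lie_neg,
      lie_add, hcomm, ← lie_skew e v]
    module
  · have h := hx ⁅e, f⁆
    rw [hef, lie_add, hcomm, add_zero, ← lie_skew, neg_eq_zero] at h
    exact h
  · rw [ad_apply, ← lie_skew, neg_eq_zero]
    exact hx _

end Reductive

/-! ### The derived bracket -/

section DerivedBracket

variable {K L : Type*} [Field K] [LieRing L] [LieAlgebra K L]

open LieAlgebra

theorem derivedBracket_ad_pow_two (e x y : L) :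
    derivedBracket (ad K L e ^ 2) x y = (2 : K) • ⁅⁅e, x⁆, ⁅e, y⁆⁆ := by
  simp only [derivedBracket, pow_two, Module.End.mul_apply, ad_apply, leibniz_lie e x y, lie_add,
    leibniz_lie e ⁅e, x⁆ y, leibniz_lie e x ⁅e, y⁆]
  module

theorem lie_lie_lie_lie_eq_zero [CharZero K] {e : L} (he : ad K L e ^ 3 = 0) (x y : L) :
    ⁅e, ⁅⁅e, x⁆, ⁅e, y⁆⁆⁆ = 0 := by
  have hE3 (v : L) : ⁅e, ⁅e, ⁅e, v⁆⁆⁆ = 0 := by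
    simpa [pow_succ] using LinearMap.congr_fun he v
  have h : (3 : K) • ⁅e, ⁅⁅e, x⁆, ⁅e, y⁆⁆⁆ = 0 := by
    have h := hE3 ⁅x, y⁆
    simp only [leibniz_lie e x y, leibniz_lie e ⁅e, x⁆ y, leibniz_lie e x ⁅e, y⁆,
      leibniz_lie e ⁅e, ⁅e, x⁆⁆ y, leibniz_lie e x ⁅e, ⁅e, y⁆⁆, leibniz_lie e ⁅e, x⁆ ⁅e, y⁆,
      lie_add, hE3, zero_lie, lie_zero] at h ⊢
    rw [← h]
    module
  exact (smul_eq_zero.mp h).resolve_left (by norm_num)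

theorem derivedBracket_derivedBracket_eq_zero [CharZero K] {e : L} (he : ad K L e ^ 3 = 0)
    (x y z : L) :
    derivedBracket (ad K L e ^ 2) x (derivedBracket (ad K L e ^ 2) y z) = 0 := by
  simp only [derivedBracket_ad_pow_two, lie_smul, lie_lie_lie_lie_eq_zero he, lie_zero, smul_zero]

theorem isLieDerivedBracket_ad_pow_two [CharZero K] {e : L} (he : ad K L e ^ 3 = 0) :
    IsLieDerivedBracket (ad K L e ^ 2) where
  alternating x := by rw [derivedBracket_ad_pow_two, lie_self, smul_zero]
  jacobi x y z := by simp only [derivedBracket_derivedBracket_eq_zero he, add_zero]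

end DerivedBracket

theorem mainTheorem7 {K L : Type*} [Field K] [CharZero K] [LieRing L] [LieAlgebra K L]
    [Module.Finite K L] [LieAlgebra.HasCentralRadical K L]
    (e : L) (he : (LieAlgebra.ad K L e) ^ 3 = 0) :
    ∃ hD : IsLieDerivedBracket ((LieAlgebra.ad K L e) ^ 2),
      ⁅(⊤ : LieIdeal K (DerivedLie _ hD)), (⊤ : LieIdeal K (DerivedLie _ hD))⁆ ≤
          LieAlgebra.center K (DerivedLie _ hD) ∧
      (LieAlgebra.center K (DerivedLie _ hD)).toSubmodule.map
          (DerivedLie.toBase _ hD).toLinearMap =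
        LinearMap.ker (LieAlgebra.ad K L e) := by
  have hD := isLieDerivedBracket_ad_pow_two he
  refine ⟨hD, ?_, ?_⟩
  · rw [LieSubmodule.lie_le_iff]
    rintro x - y -
    rw [LieModule.mem_maxTrivSubmodule]
    exact fun z ↦ derivedBracket_derivedBracket_eq_zero he z x y
  · ext x
    simp only [Submodule.mem_map, LieSubmodule.mem_toSubmodule, LieModule.mem_maxTrivSubmodule,
      LinearMap.mem_ker, LieAlgebra.ad_apply]
    constructor
    · rintro ⟨x, hx, rfl⟩
      refine lie_eq_zero_of_forall_lie_lie_eq_zero he fun y ↦ ?_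
      have h : derivedBracket (LieAlgebra.ad K L e ^ 2) y (DerivedLie.toBase _ hD x) = 0 :=
        hx ((DerivedLie.toBase _ hD).symm y)
      rw [derivedBracket_ad_pow_two] at h
      rw [← lie_skew, neg_eq_zero]
      exact (smul_eq_zero.mp h).resolve_left two_ne_zero
    · intro hx
      refine ⟨(DerivedLie.toBase _ hD).symm x, fun y ↦ ?_, LinearEquiv.apply_symm_apply _ x⟩
      apply (DerivedLie.toBase _ hD).injective
      rw [DerivedLie.toBase_lie, derivedBracket_ad_pow_two, LinearEquiv.apply_symm_apply, hx,
        lie_zero, smul_zero, map_zero]
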